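/- Let $J=\begin{pmatrix}J_{11}&J_{12}\\J_{12}&J_{22}\end{pmatrix}$ be a positive definite real symmetric matrix all of whose entries are positive, and write $$J^{-1}=\begin{pmatrix}L_{11}&-L_{12}\\-L_{12}&L_{22}\end{pmatrix}.$$ Let $\alpha_1,\alpha_2>0$ with $\alpha_1+\alpha_2=1$. For $n\in\mathbb{N}$ let $N_1=N_1(n)$, $N_2=N_2(n)$ be natural numbers and $N=N_1+N_2$, such that $N_\lambda\to\infty$ and $N_\lambda/N\to\alpha_\lambda$ as $n\to\infty$ for $\lambda=1,2$. (In particular, one may take $N=n$.) Let $X=(X_{11},\dots,X_{1N_1},X_{21},\dots,X_{2N_2})$ be a random spin configuration in $\{-1,1\}^{N}$ with the two-group Curie–Weiss distribution $$\mathbb{P}(X=x)=Z^{-1}e^{-\mathbb{H}(x)},\qquad \mathbb{H}(x)=-\frac{1}{2N}\sum_{\lambda,\mu=1}^{2}J_{\lambda\mu}\sum_{i=1}^{N_\lambda}\sum_{j=1}^{N_\mu}x_{\lambda i}x_{\mu j},$$ where $Z$ is the normalising constant, and let $S_\lambda=\sum_{i=1}^{N_\lambda}X_{\lambda i}$, $\lambda=1,2$.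 Assume that the model is in the low temperature regime, i.e. that the matrix $J^{-1}-\operatorname{diag}(\alpha_1,\alpha_2)$ is neither positive definite nor positive semi-definite. Then the system $$L_{11}x-L_{12}y-\alpha_1\tanh x=0,\qquad L_{22}y-L_{12}x-\alpha_2\tanh y=0$$ has exactly one solution $(x^*,y^*)$ with $x^*>0$ and $y^*>0$. Moreover, $m^*:=(\tanh x^*,\tanh y^*)$ lies in $(0,1)^2$, and, as $n\to\infty$, $$\left(\frac{S_1}{N_1},\frac{S_2}{N_2}\right)\Longrightarrow\frac12\left(\delta_{-m^*}+\delta_{m^*}\right)$$ in the sense of weak convergence of probability measures on $\mathbb{R}^2$. -/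

import Mathlib

open scoped BigOperators ENNReal Topology

namespace CurieWeiss

/-- Spin configurations of `M` groups, group `l` having `N l` spins with values in
`{-1, 1}` (the units of `ℤ`). -/
abbrev Config {M : ℕ} (N : Fin M → ℕ) : Type :=
  (l : Fin M) → Fin (N l) → ℤˣ

/-- The value of a spin as a real number. -/
def spin (u : ℤˣ) : ℝ := ((u : ℤ) : ℝ)

/-- The size of the whole population. -/
def totalSize {M : ℕ} (N : Fin M → ℕ) : ℕ := ∑ l, N l

/-- The Hamiltonian of the multi-group Curie-Weiss model with coupling matrix `J`. -/
noncomputable def hamiltonian {M : ℕ} (J : Matrix (Fin M) (Fin M) ℝ) (N : Fin M → ℕ)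
    (x : Config N) : ℝ :=
  -(1 / (2 * (totalSize N : ℝ))) *
    ∑ l, ∑ m, J l m * ∑ i, ∑ j, spin (x l i) * spin (x m j)

/-- The normalisation constant. -/
noncomputable def partitionFunction {M : ℕ} (J : Matrix (Fin M) (Fin M) ℝ)
    (N : Fin M → ℕ) : ℝ :=
  ∑ x : Config N, Real.exp (-hamiltonian J N x)

theorem partitionFunction_pos {M : ℕ} (J : Matrix (Fin M) (Fin M) ℝ) (N : Fin M → ℕ) :
    0 < partitionFunction J N :=
  Finset.sum_pos (fun _ _ => Real.exp_pos _) Finset.univ_nonempty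

theorem sum_gibbs_weight {M : ℕ} (J : Matrix (Fin M) (Fin M) ℝ) (N : Fin M → ℕ) :
    ∑ x : Config N,
      ENNReal.ofReal ((partitionFunction J N)⁻¹ * Real.exp (-hamiltonian J N x)) = 1 := by
  have hZ := partitionFunction_pos J N
  rw [← ENNReal.ofReal_sum_of_nonneg
    (fun x _ => mul_nonneg (inv_nonneg.mpr hZ.le) (Real.exp_pos _).le), ← Finset.mul_sum]
  have h : (partitionFunction J N)⁻¹ * ∑ x : Config N, Real.exp (-hamiltonian J N x) = 1 :=
    inv_mul_cancel₀ hZ.ne'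
  rw [h, ENNReal.ofReal_one]

/-- The canonical ensemble: configuration `x` has probability `Z⁻¹ exp (-H x)`. -/
noncomputable def gibbs {M : ℕ} (J : Matrix (Fin M) (Fin M) ℝ) (N : Fin M → ℕ) :
    PMF (Config N) :=
  PMF.ofFintype
    (fun x => ENNReal.ofReal ((partitionFunction J N)⁻¹ * Real.exp (-hamiltonian J N x)))
    (sum_gibbs_weight J N)

/-- The vector `(S₁, …, S_M)` of group magnetisations. -/
def magnetisation {M : ℕ} (N : Fin M → ℕ) (x : Config N) : Fin M → ℝ :=
  fun l => ∑ i, spin (x l i)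

/-- The law of `(S₁ / N₁, …, S_M / N_M)` under the canonical ensemble. -/
noncomputable def meanLaw {M : ℕ} (J : Matrix (Fin M) (Fin M) ℝ) (N : Fin M → ℕ) :
    MeasureTheory.ProbabilityMeasure (Fin M → ℝ) :=
  ⟨((gibbs J N).map (fun x l => magnetisation N x l / (N l : ℝ))).toMeasure, inferInstance⟩

/-- The probability measure `(δ_{-m} + δ_m) / 2`. -/
noncomputable def twoPoint {M : ℕ} (m : Fin M → ℝ) :
    MeasureTheory.ProbabilityMeasure (Fin M → ℝ) :=
  ⟨(2⁻¹ : ℝ≥0∞) • (MeasureTheory.Measure.dirac (-m) + MeasureTheory.Measure.dirac m), ⟨by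
    simp only [MeasureTheory.Measure.smul_apply, MeasureTheory.Measure.add_apply,
      MeasureTheory.measure_univ, smul_eq_mul]
    rw [one_add_one_eq_two]
    exact ENNReal.inv_mul_cancel (by norm_num) (by norm_num)⟩⟩

/-- The parameter space: asymptotic relative group sizes, and a positive definite
(in particular symmetric) coupling matrix. -/
def parameterSpace (M : ℕ) : Set ((Fin M → ℝ) × Matrix (Fin M) (Fin M) ℝ) :=
  {φ | (∀ l, 0 ≤ φ.1 l) ∧ ∑ l, φ.1 l = 1 ∧ φ.2.PosDef}

/-- The matrix `J⁻¹ - diag (α₁, …, α_M)`. -/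
noncomputable def hessian {M : ℕ} (α : Fin M → ℝ) (J : Matrix (Fin M) (Fin M) ℝ) :
    Matrix (Fin M) (Fin M) ℝ :=
  J⁻¹ - Matrix.diagonal α

def highTemperature (M : ℕ) : Set ((Fin M → ℝ) × Matrix (Fin M) (Fin M) ℝ) :=
  {φ | φ ∈ parameterSpace M ∧ (hessian φ.1 φ.2).PosDef}

def criticalRegime (M : ℕ) : Set ((Fin M → ℝ) × Matrix (Fin M) (Fin M) ℝ) :=
  {φ | φ ∈ parameterSpace M ∧ (hessian φ.1 φ.2).PosSemidef ∧ ¬ (hessian φ.1 φ.2).PosDef}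

def lowTemperature (M : ℕ) : Set ((Fin M → ℝ) × Matrix (Fin M) (Fin M) ℝ) :=
  parameterSpace M \ (highTemperature M ∪ criticalRegime M)

/-- The entry `L₁₁` of `L = J⁻¹ = !![L₁₁, -L₁₂; -L₁₂, L₂₂]`. -/
noncomputable def L11 (J : Matrix (Fin 2) (Fin 2) ℝ) : ℝ := J⁻¹ 0 0

/-- `L₁₂` is minus the off-diagonal entry of `J⁻¹`. -/
noncomputable def L12 (J : Matrix (Fin 2) (Fin 2) ℝ) : ℝ := -J⁻¹ 0 1

/-- The entry `L₂₂` of `J⁻¹`. -/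
noncomputable def L22 (J : Matrix (Fin 2) (Fin 2) ℝ) : ℝ := J⁻¹ 1 1

/-- `p` lies in the open first quadrant (the origin always solves the system) and solves
the equation system. -/
def IsFirstQuadrantSolution (J : Matrix (Fin 2) (Fin 2) ℝ) (α : Fin 2 → ℝ)
    (p : ℝ × ℝ) : Prop :=
  0 < p.1 ∧ 0 < p.2 ∧
    L11 J * p.1 - L12 J * p.2 - α 0 * Real.tanh p.1 = 0 ∧
    L22 J * p.2 - L12 J * p.1 - α 1 * Real.tanh p.2 = 0

end CurieWeiss

/-! With T the total size and E(u) = (u, Ju)/2, the Gibbs weight is exp(T E(S/T)). E is quadratic,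
so E(u) = (u, Jv) - E(v) + E(u - v) exactly (`energyDensity_tangent`), and the part linear in u
turns the sum over spins into a product of cosh's. Dropping E(u - v) ≥ 0 bounds the partition
function below by exp(T(log 2 - F(v))), F being `freeEnergy`; near v that term is small, which gives
the matching upper bound. Hence neighbourhoods of non-minimisers of F have exponentially small
probability, and spin-flip symmetry gives the two remaining points ±m equal mass.

The substitution p = Ju turns F into `dualEnergy`, whose critical equations are the system of the
theorem. A minimum exists by coercivity, and low temperature makes it negative, so it is not at the
origin. As c > 0, passing to absolute values does not raise the energy, and a minimiser has no zero
coordinate. The critical point in the open quadrant is unique because tanh x / x is strictly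
decreasing (`positive_critical_le`); so the minimisers are exactly ±p. -/

namespace CurieWeiss

/-! ### Inequalities for tanh and log cosh -/

theorem tanh_pos {x : ℝ} (hx : 0 < x) : 0 < Real.tanh x := by
  rw [Real.tanh_eq_sinh_div_cosh]
  exact div_pos (Real.sinh_pos_iff.mpr hx) (Real.cosh_pos x)

theorem strictConvexOn_sinh : StrictConvexOn ℝ (Set.Ici 0) Real.sinh := by
  apply StrictMonoOn.strictConvexOn_of_deriv (convex_Ici 0) Real.continuous_sinh.continuousOn
  rw [Real.deriv_sinh, interior_Ici]
  exact Real.cosh_strictMonoOn.mono Set.Ioi_subset_Ici_self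

theorem mul_sinh_lt_mul_sinh {d s : ℝ} (hd : 0 < d) (hds : d < s) :
    s * Real.sinh d < d * Real.sinh s := by
  have hs : 0 < s := hd.trans hds
  have h0 : 0 < 1 - d / s := by rw [sub_pos, div_lt_one hs]; exact hds
  have h := strictConvexOn_sinh.2 (Set.mem_Ici.mpr le_rfl) (Set.mem_Ici.mpr hs.le) hs.ne h0
    (div_pos hd hs) (sub_add_cancel 1 (d / s))
  simp only [smul_eq_mul, mul_zero, zero_add, Real.sinh_zero, div_mul_cancel₀ d hs.ne'] at h
  calc s * Real.sinh d < s * (d / s * Real.sinh s) := by gcongr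
    _ = d * Real.sinh s := by field_simp

/-- Monotonicity of tanh x / x: after multiplying by cosh x cosh z, the addition formulas reduce it
to `mul_sinh_lt_mul_sinh` with d = z - x and s = z + x. -/
theorem mul_tanh_lt_mul_tanh {x z : ℝ} (hx : 0 < x) (hxz : x < z) :
    x * Real.tanh z < z * Real.tanh x := by
  have h := mul_sinh_lt_mul_sinh (sub_pos.mpr hxz) (show z - x < z + x by linarith)
  rw [Real.sinh_sub, Real.sinh_add] at h
  rw [Real.tanh_eq_sinh_div_cosh, Real.tanh_eq_sinh_div_cosh, mul_div_assoc', mul_div_assoc',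
    div_lt_div_iff₀ (Real.cosh_pos z) (Real.cosh_pos x)]
  linarith

theorem log_cosh_abs (x : ℝ) : Real.log (Real.cosh |x|) = Real.log (Real.cosh x) := by
  rw [Real.cosh_abs]

theorem log_cosh_le_abs (x : ℝ) : Real.log (Real.cosh x) ≤ |x| := by
  rw [← log_cosh_abs, Real.log_le_iff_le_exp (Real.cosh_pos _), ← Real.cosh_add_sinh]
  linarith [Real.sinh_nonneg_iff.mpr (abs_nonneg x)]

theorem sq_sub_le_log_cosh (x : ℝ) : x ^ 2 / 2 - x ^ 4 / 4 ≤ Real.log (Real.cosh x) := by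
  have h1 : 1 + x ^ 2 / 2 ≤ Real.cosh x := by
    have h := Real.self_le_sinh_iff.mpr (div_nonneg (abs_nonneg x) zero_le_two)
    have h2 : Real.cosh x = 1 + 2 * Real.sinh (|x| / 2) ^ 2 := by
      rw [← Real.cosh_abs, ← mul_div_cancel₀ |x| (two_ne_zero' ℝ), Real.cosh_two_mul,
        Real.cosh_sq, mul_div_cancel_left₀ _ (two_ne_zero' ℝ)]
      ring
    have h3 : (|x| / 2) ^ 2 ≤ Real.sinh (|x| / 2) ^ 2 := pow_le_pow_left₀ (by positivity) h 2
    rw [div_pow, sq_abs] at h3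
    linarith
  have h2 : 0 < 1 + x ^ 2 / 2 := by positivity
  calc x ^ 2 / 2 - x ^ 4 / 4 ≤ 1 - (1 + x ^ 2 / 2)⁻¹ := by
        rw [le_sub_iff_add_le, ← le_sub_iff_add_le', inv_le_iff_one_le_mul₀ h2]
        nlinarith [sq_nonneg (x ^ 3)]
    _ ≤ Real.log (1 + x ^ 2 / 2) := Real.one_sub_inv_le_log_of_pos h2
    _ ≤ _ := Real.log_le_log h2 h1

theorem continuous_log_cosh : Continuous fun x => Real.log (Real.cosh x) :=
  Real.continuous_cosh.log fun x => (Real.cosh_pos x).ne'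

theorem hasDerivAt_log_cosh (x : ℝ) :
    HasDerivAt (fun x => Real.log (Real.cosh x)) (Real.tanh x) x := by
  rw [Real.tanh_eq_sinh_div_cosh]
  exact (Real.hasDerivAt_cosh x).log (Real.cosh_pos x).ne'

/-! ### Minimisers of the dual energy -/

/-- The limiting free energy of two groups in the dual variables, where the inverse coupling
matrix is `!![a, -c; -c, b]`. -/
noncomputable def dualEnergy (a b c α β : ℝ) (p : ℝ × ℝ) : ℝ :=
  (a * p.1 ^ 2 - 2 * c * p.1 * p.2 + b * p.2 ^ 2) / 2
    - α * Real.log (Real.cosh p.1) - β * Real.log (Real.cosh p.2)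

theorem continuous_dualEnergy (a b c α β : ℝ) : Continuous (dualEnergy a b c α β) := by
  have h1 := continuous_log_cosh.comp (continuous_fst (X := ℝ) (Y := ℝ))
  have h2 := continuous_log_cosh.comp (continuous_snd (X := ℝ) (Y := ℝ))
  simp only [Function.comp_def] at h1 h2
  unfold dualEnergy
  fun_prop

/-- For A = !![a, -c; -c, b], Cayley–Hamilton gives (a + b)A - det A = A², so the difference is
|Av|² / (a + b). In the proof, `key` completes a square after scaling by a² + c². -/
theorem quadratic_lower_bound {a b c : ℝ} (ha : 0 < a) (hb : 0 < b) (x y : ℝ) :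
    (a * b - c ^ 2) / (a + b) * (x ^ 2 + y ^ 2) ≤ a * x ^ 2 - 2 * c * x * y + b * y ^ 2 := by
  have hab : 0 < a + b := by positivity
  rw [div_mul_eq_mul_div, div_le_iff₀ hab]
  have h : 0 < a ^ 2 + c ^ 2 := by positivity
  have key : (a ^ 2 + c ^ 2) * ((a * x ^ 2 - 2 * c * x * y + b * y ^ 2) * (a + b)
      - (a * b - c ^ 2) * (x ^ 2 + y ^ 2))
      = ((a ^ 2 + c ^ 2) * x - c * (a + b) * y) ^ 2 + ((a * b - c ^ 2) * y) ^ 2 := by ring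
  have h2 := nonneg_of_mul_nonneg_right (key ▸ by positivity :
    0 ≤ (a ^ 2 + c ^ 2) * ((a * x ^ 2 - 2 * c * x * y + b * y ^ 2) * (a + b)
      - (a * b - c ^ 2) * (x ^ 2 + y ^ 2))) h
  linarith

/-- Coercivity: the quadratic part grows like k‖p‖², the log cosh terms at most linearly, so the
sublevel set of the origin is bounded. -/
theorem exists_isMin_dualEnergy {a b c α β : ℝ} (ha : 0 < a) (hb : 0 < b)
    (hdet : c ^ 2 < a * b) (hα : 0 < α) (hβ : 0 < β) :
    ∃ p, ∀ q, dualEnergy a b c α β p ≤ dualEnergy a b c α β q := by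
  apply (continuous_dualEnergy a b c α β).exists_forall_le_of_isBounded (0, 0)
  set k := (a * b - c ^ 2) / (a + b) with hk
  have hk0 : 0 < k := div_pos (sub_pos.mpr hdet) (by positivity)
  rw [isBounded_iff_forall_norm_le]
  refine ⟨2 * (α + β) / k, fun p hp => ?_⟩
  have h0 : dualEnergy a b c α β (0, 0) = 0 := by simp [dualEnergy]
  rw [Set.mem_ofPred_eq, h0, dualEnergy] at hp
  have hq := quadratic_lower_bound (c := c) ha hb p.1 p.2
  have h1 : |p.1| ≤ ‖p‖ := norm_fst_le p
  have h2 : |p.2| ≤ ‖p‖ := norm_snd_le p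
  have h3 : ‖p‖ ^ 2 ≤ p.1 ^ 2 + p.2 ^ 2 := by
    rcases max_choice ‖p.1‖ ‖p.2‖ with h | h <;> rw [Prod.norm_def, h, Real.norm_eq_abs, sq_abs] <;>
      nlinarith [sq_nonneg p.1, sq_nonneg p.2]
  have h4 : α * Real.log (Real.cosh p.1) ≤ α * ‖p‖ := by
    gcongr; exact (log_cosh_le_abs _).trans h1
  have h5 : β * Real.log (Real.cosh p.2) ≤ β * ‖p‖ := by
    gcongr; exact (log_cosh_le_abs _).trans h2
  have h6 : k * ‖p‖ ^ 2 ≤ 2 * (α + β) * ‖p‖ := by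
    have := mul_le_mul_of_nonneg_left h3 hk0.le
    linarith
  rw [le_div_iff₀ hk0]
  rcases (norm_nonneg p).eq_or_lt with h | h
  · rw [← h]; nlinarith
  · nlinarith

theorem critical_of_isMin {a b c α β : ℝ} {p : ℝ × ℝ}
    (hp : ∀ q, dualEnergy a b c α β p ≤ dualEnergy a b c α β q) :
    a * p.1 - c * p.2 - α * Real.tanh p.1 = 0 ∧ b * p.2 - c * p.1 - β * Real.tanh p.2 = 0 := by
  constructor
  · have h : HasDerivAt (fun t => dualEnergy a b c α β (t, p.2))
        (a * p.1 - c * p.2 - α * Real.tanh p.1) p.1 := by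
      have h1 := (((((hasDerivAt_id p.1).pow 2).const_mul a).sub
        (((hasDerivAt_id p.1).const_mul (2 * c)).mul_const p.2)).add_const (b * p.2 ^ 2)).div_const 2
      have h2 := (h1.sub ((hasDerivAt_log_cosh p.1).const_mul α)).sub_const
        (β * Real.log (Real.cosh p.2))
      refine h2.congr_deriv ?_
      simp
      ring
    exact IsLocalMin.hasDerivAt_eq_zero (Filter.Eventually.of_forall fun t => hp _) h
  · have h : HasDerivAt (fun t => dualEnergy a b c α β (p.1, t))
        (b * p.2 - c * p.1 - β * Real.tanh p.2) p.2 := by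
      have h1 := ((((hasDerivAt_id p.2).const_mul (2 * c * p.1)).const_sub (a * p.1 ^ 2)).add
        (((hasDerivAt_id p.2).pow 2).const_mul b)).div_const 2
      have h2 := (h1.sub_const (α * Real.log (Real.cosh p.1))).sub
        ((hasDerivAt_log_cosh p.2).const_mul β)
      refine h2.congr_deriv ?_
      simp
      ring
    exact IsLocalMin.hasDerivAt_eq_zero (Filter.Eventually.of_forall fun t => hp _) h

/-- If x < z, the first equation, c y/x = a - α tanh x / x, forces y/x < w/z, hence y < w. The
second equation then gives x/y < z/w in the same way, a contradiction. -/
theorem positive_critical_le {a b c α β : ℝ} (hc : 0 < c) (hα : 0 < α) (hβ : 0 < β)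
    {x y z w : ℝ} (hx : 0 < x) (hy : 0 < y)
    (h1 : a * x - c * y - α * Real.tanh x = 0) (h2 : b * y - c * x - β * Real.tanh y = 0)
    (h3 : a * z - c * w - α * Real.tanh z = 0) (h4 : b * w - c * z - β * Real.tanh w = 0) :
    z ≤ x := by
  by_contra! hxz
  have hz : 0 < z := hx.trans hxz
  have e1 := mul_lt_mul_of_pos_left (mul_tanh_lt_mul_tanh hx hxz) hα
  have e2 : y * z < w * x := by
    refine lt_of_mul_lt_mul_left ?_ hc.le
    linear_combination e1 - z * h1 + x * h3
  have hyw : y < w := by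
    by_contra! h
    linarith [mul_le_mul h hxz.le hx.le hy.le]
  have e3 := mul_lt_mul_of_pos_left (mul_tanh_lt_mul_tanh hy hyw) hβ
  have e4 : x * w < z * y := by
    refine lt_of_mul_lt_mul_left ?_ hc.le
    linear_combination e3 - w * h2 + y * h4
  linarith

theorem positive_critical_unique {a b c α β : ℝ} (hc : 0 < c) (hα : 0 < α) (hβ : 0 < β)
    {x y z w : ℝ} (hx : 0 < x) (hy : 0 < y) (hz : 0 < z) (hw : 0 < w)
    (h1 : a * x - c * y - α * Real.tanh x = 0) (h2 : b * y - c * x - β * Real.tanh y = 0)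
    (h3 : a * z - c * w - α * Real.tanh z = 0) (h4 : b * w - c * z - β * Real.tanh w = 0) :
    z = x ∧ w = y := by
  have h : z = x := le_antisymm (positive_critical_le hc hα hβ hx hy h1 h2 h3 h4)
    (positive_critical_le hc hα hβ hz hw h3 h4 h1 h2)
  subst h
  exact ⟨rfl, mul_left_cancel₀ hc.ne' (by linarith)⟩

theorem exists_dualEnergy_neg {a b c α β : ℝ} (hα : 0 < α) (hβ : 0 < β) {x y : ℝ}
    (h : (a - α) * x ^ 2 - 2 * c * x * y + (b - β) * y ^ 2 < 0) :
    ∃ p, dualEnergy a b c α β p < 0 := by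
  set Q := (a - α) * x ^ 2 - 2 * c * x * y + (b - β) * y ^ 2 with hQ
  set R := α * x ^ 4 + β * y ^ 4 with hR
  have hR0 : 0 ≤ R := by positivity
  -- On this ray the energy is at most sQ/2 + s²R/4; this s makes sR ≤ -Q, so the bound is at most
  -- sQ/4 < 0. The added 1 keeps the denominator positive.
  set s := -Q / (R + 1) with hs
  have hs0 : 0 < s := div_pos (neg_pos.mpr h) (by positivity)
  refine ⟨(Real.sqrt s * x, Real.sqrt s * y), ?_⟩
  have e1 := mul_le_mul_of_nonneg_left (sq_sub_le_log_cosh (Real.sqrt s * x)) hα.le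
  have e2 := mul_le_mul_of_nonneg_left (sq_sub_le_log_cosh (Real.sqrt s * y)) hβ.le
  have q2 : Real.sqrt s ^ 2 = s := Real.sq_sqrt hs0.le
  have q4 : Real.sqrt s ^ 4 = s ^ 2 := by
    calc Real.sqrt s ^ 4 = (Real.sqrt s ^ 2) ^ 2 := by ring
      _ = s ^ 2 := by rw [q2]
  have hsR : s * (R + 1) = -Q := div_mul_cancel₀ _ (by positivity)
  simp only [mul_pow, q2, q4] at e1 e2
  have e3 : dualEnergy a b c α β (Real.sqrt s * x, Real.sqrt s * y)
      ≤ s * Q / 2 + s ^ 2 * R / 4 := by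
    simp only [dualEnergy, mul_pow, q2]
    have : c * (Real.sqrt s * x) * (Real.sqrt s * y) = s * (c * x * y) := by
      linear_combination c * x * y * q2
    rw [hQ, hR]
    linear_combination e1 + e2 - this
  have e4 : s * (s * R) ≤ s * -Q := by gcongr; linarith
  nlinarith [mul_pos hs0 (neg_pos.mpr h)]

theorem dualEnergy_abs_le {a b c : ℝ} (hc : 0 < c) (α β : ℝ) (p : ℝ × ℝ) :
    dualEnergy a b c α β (|p.1|, |p.2|) ≤ dualEnergy a b c α β p := by
  simp only [dualEnergy, Real.cosh_abs, sq_abs]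
  have h : p.1 * p.2 ≤ |p.1| * |p.2| := by rw [← abs_mul]; exact le_abs_self _
  nlinarith

theorem dualEnergy_abs_lt {a b c : ℝ} (hc : 0 < c) (α β : ℝ) {p : ℝ × ℝ} (hp : p.1 * p.2 < 0) :
    dualEnergy a b c α β (|p.1|, |p.2|) < dualEnergy a b c α β p := by
  simp only [dualEnergy, Real.cosh_abs, sq_abs]
  have h : p.1 * p.2 < |p.1| * |p.2| := by
    rw [← abs_mul]; exact hp.trans_le (abs_nonneg _)
  nlinarith

/-- The minimum is negative, so p ≠ 0; if one coordinate vanished, its critical equation would make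
c times the other one zero. -/
theorem abs_minimizer_pos {a b c α β : ℝ} (hc : 0 < c) {r : ℝ × ℝ}
    (hr : dualEnergy a b c α β r < 0) {p : ℝ × ℝ}
    (hp : ∀ q, dualEnergy a b c α β p ≤ dualEnergy a b c α β q) :
    0 < |p.1| ∧ 0 < |p.2| := by
  have hcr := critical_of_isMin hp
  have key : p.1 ≠ 0 ∨ p.2 ≠ 0 := by
    by_contra! h
    have h0 := hp r
    simp only [dualEnergy, h.1, h.2] at h0 hr
    simp at h0
    linarith
  rw [abs_pos, abs_pos]
  constructor
  · intro h
    have := hcr.1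
    simp [h, hc.ne'] at this
    simp [h, this] at key
  · intro h
    have := hcr.2
    simp [h, hc.ne'] at this
    simp [h, this] at key

/-- At low temperature there is exactly one positive critical point, and the free energy is
minimal exactly at this point and its negative. -/
theorem exists_positive_critical_point {a b c α β : ℝ} (ha : 0 < a) (hb : 0 < b) (hc : 0 < c)
    (hdet : c ^ 2 < a * b) (hα : 0 < α) (hβ : 0 < β) {x y : ℝ}
    (h : (a - α) * x ^ 2 - 2 * c * x * y + (b - β) * y ^ 2 < 0) :
    ∃ p : ℝ × ℝ, 0 < p.1 ∧ 0 < p.2 ∧ a * p.1 - c * p.2 - α * Real.tanh p.1 = 0 ∧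
      b * p.2 - c * p.1 - β * Real.tanh p.2 = 0 ∧
      ∀ q, q ≠ p → q ≠ -p → dualEnergy a b c α β p < dualEnergy a b c α β q := by
  obtain ⟨r, hr⟩ := exists_dualEnergy_neg hα hβ h
  obtain ⟨p₀, hp₀⟩ := exists_isMin_dualEnergy ha hb hdet hα hβ
  have abs_min : ∀ p : ℝ × ℝ, (∀ q, dualEnergy a b c α β p ≤ dualEnergy a b c α β q) →
      ∀ q, dualEnergy a b c α β (|p.1|, |p.2|) ≤ dualEnergy a b c α β q :=
    fun p hp q => (dualEnergy_abs_le hc α β p).trans (hp q)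
  have hpos := abs_minimizer_pos hc hr hp₀
  have hmin := abs_min p₀ hp₀
  have hcr := critical_of_isMin hmin
  refine ⟨(|p₀.1|, |p₀.2|), hpos.1, hpos.2, hcr.1, hcr.2, fun q hq hq' => ?_⟩
  refine lt_of_le_of_ne (hmin q) fun heq => ?_
  -- Another minimiser q has |q| in the open quadrant and critical, hence equal to p; opposite signs
  -- in q are excluded because |q| would have strictly lower energy.
  have hqmin : ∀ s, dualEnergy a b c α β q ≤ dualEnergy a b c α β s := fun s => heq ▸ hmin s
  have hqpos := abs_minimizer_pos hc hr hqmin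
  have hqcr := critical_of_isMin (abs_min q hqmin)
  obtain ⟨e1, e2⟩ := positive_critical_unique hc hα hβ hpos.1 hpos.2 hqpos.1 hqpos.2
    hcr.1 hcr.2 hqcr.1 hqcr.2
  have hsign : 0 ≤ q.1 * q.2 := by
    by_contra! hneg
    exact absurd (hqmin (|q.1|, |q.2|)) (not_le.mpr (dualEnergy_abs_lt hc α β hneg))
  have h1 := abs_pos.mp hqpos.1
  rcases lt_or_gt_of_ne h1 with hlt | hgt
  · have h2 : q.2 ≤ 0 := nonpos_of_mul_nonneg_right hsign hlt
    refine hq' (Prod.ext ?_ ?_)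
    · simp [← e1, abs_of_neg hlt]
    · simp [← e2, abs_of_nonpos h2]
  · have h2 : 0 ≤ q.2 := nonneg_of_mul_nonneg_right hsign hgt
    refine hq (Prod.ext ?_ ?_)
    · simp [← e1, abs_of_pos hgt]
    · simp [← e2, abs_of_nonneg h2]

/-! ### Energy density and product sums -/

open Filter

variable {M : ℕ}

/-- The energy density `(u, J u) / 2`. -/
noncomputable def energyDensity (J : Matrix (Fin M) (Fin M) ℝ) (u : Fin M → ℝ) : ℝ :=
  (u ⬝ᵥ J.mulVec u) / 2

/-- The free energy at `J u`, for relative group sizes `β`. -/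
noncomputable def freeEnergy (J : Matrix (Fin M) (Fin M) ℝ) (β u : Fin M → ℝ) : ℝ :=
  energyDensity J u - ∑ l, β l * Real.log (Real.cosh (J.mulVec u l))

/-- The vector of group means. -/
noncomputable def groupMean (N : Fin M → ℕ) (x : Config N) (l : Fin M) : ℝ :=
  magnetisation N x l / N l

/-- The expectation of a function of the group means. -/
noncomputable def expectation (J : Matrix (Fin M) (Fin M) ℝ) (N : Fin M → ℕ)
    (f : (Fin M → ℝ) → ℝ) : ℝ :=
  ∑ x : Config N, (partitionFunction J N)⁻¹ * Real.exp (-hamiltonian J N x) * f (groupMean N x)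

theorem continuous_energyDensity (J : Matrix (Fin M) (Fin M) ℝ) :
    Continuous (energyDensity J) := by
  unfold energyDensity dotProduct Matrix.mulVec dotProduct
  fun_prop

theorem energyDensity_tangent {J : Matrix (Fin M) (Fin M) ℝ} (hJ : J.IsSymm)
    (u v : Fin M → ℝ) :
    energyDensity J u = u ⬝ᵥ J.mulVec v - energyDensity J v + energyDensity J (u - v) := by
  have h : v ⬝ᵥ J.mulVec u = u ⬝ᵥ J.mulVec v := by
    rw [Matrix.dotProduct_mulVec, ← Matrix.mulVec_transpose, hJ.eq, dotProduct_comm]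
  simp only [energyDensity, Matrix.mulVec_sub, dotProduct_sub, sub_dotProduct, h]
  ring

theorem neg_hamiltonian_eq (J : Matrix (Fin M) (Fin M) ℝ) (N : Fin M → ℕ)
    (hN : 0 < totalSize N) (x : Config N) :
    -hamiltonian J N x =
      totalSize N * energyDensity J fun l => magnetisation N x l / totalSize N := by
  have hT : (totalSize N : ℝ) ≠ 0 := by exact_mod_cast hN.ne'
  have h : ∀ l m, ∑ i, ∑ j, spin (x l i) * spin (x m j)
      = magnetisation N x l * magnetisation N x m := fun l m => by
    simp only [magnetisation, Finset.sum_mul_sum]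
  simp only [hamiltonian, h, energyDensity, dotProduct, Matrix.mulVec, Finset.mul_sum,
    Finset.sum_div, ← Finset.sum_neg_distrib]
  refine Finset.sum_congr rfl fun l _ => Finset.sum_congr rfl fun m _ => ?_
  field_simp

theorem abs_magnetisation_le (N : Fin M → ℕ) (x : Config N) (l : Fin M) :
    |magnetisation N x l| ≤ N l := by
  calc |magnetisation N x l| ≤ ∑ i, |spin (x l i)| := Finset.abs_sum_le_sum_abs _ _
    _ = ∑ _i : Fin (N l), (1 : ℝ) := Finset.sum_congr rfl fun i _ => by
        rcases Int.units_eq_one_or (x l i) with h | h <;> simp [spin, h]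
    _ = N l := by simp

theorem mul_groupMean (N : Fin M → ℕ) (x : Config N) (l : Fin M) :
    N l * groupMean N x l = magnetisation N x l := by
  -- For an empty group the mean is 0 by the division convention and the magnetisation is an empty
  -- sum.
  rcases eq_or_ne (N l : ℝ) 0 with h | h
  · have := abs_magnetisation_le N x l
    rw [h] at this ⊢
    rw [zero_mul, abs_nonpos_iff.mp this]
  · exact mul_div_cancel₀ _ h

theorem abs_groupMean_le_one (N : Fin M → ℕ) (x : Config N) (l : Fin M) :
    |groupMean N x l| ≤ 1 := by
  rw [groupMean, abs_div, Nat.abs_cast]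
  exact div_le_one_of_le₀ (abs_magnetisation_le N x l) (Nat.cast_nonneg _)

theorem sum_exp_spin (y : ℝ) : ∑ u : ℤˣ, Real.exp (y * spin u) = 2 * Real.cosh y := by
  have h : (Finset.univ : Finset ℤˣ) = {1, -1} := rfl
  rw [h, Finset.sum_pair (by decide), Real.cosh_eq]
  simp [spin]
  ring

theorem sum_exp_magnetisation (N : Fin M → ℕ) (y : Fin M → ℝ) :
    ∑ x : Config N, Real.exp (∑ l, y l * magnetisation N x l)
      = ∏ l, (2 * Real.cosh (y l)) ^ N l := by
  have h : ∀ x : Config N, Real.exp (∑ l, y l * magnetisation N x l)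
      = ∏ l, ∏ i, Real.exp (y l * spin (x l i)) := fun x => by
    simp only [magnetisation, Finset.mul_sum, Real.exp_sum]
  simp only [h]
  rw [← Fintype.prod_sum fun l (z : Fin (N l) → ℤˣ) => ∏ i, Real.exp (y l * spin (z i))]
  refine Finset.prod_congr rfl fun l _ => ?_
  rw [← Fintype.prod_sum fun (_ : Fin (N l)) u => Real.exp (y l * spin u)]
  simp only [sum_exp_spin, Finset.prod_const, Finset.card_univ, Fintype.card_fin]

theorem sum_exp_dotProduct (N : Fin M → ℕ) (hN : 0 < totalSize N) (y : Fin M → ℝ) :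
    ∑ x : Config N, Real.exp (totalSize N *
        ((fun l => magnetisation N x l / totalSize N) ⬝ᵥ y))
      = Real.exp (totalSize N * (Real.log 2 +
        ∑ l, (N l : ℝ) / totalSize N * Real.log (Real.cosh (y l)))) := by
  have hT : (totalSize N : ℝ) ≠ 0 := by exact_mod_cast hN.ne'
  have h1 : ∀ x : Config N, (totalSize N : ℝ) *
      ((fun l => magnetisation N x l / totalSize N) ⬝ᵥ y) = ∑ l, y l * magnetisation N x l := by
    intro x
    rw [dotProduct, Finset.mul_sum]
    refine Finset.sum_congr rfl fun l _ => ?_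
    field_simp
  have h2 : (totalSize N : ℝ) * (Real.log 2 +
      ∑ l, (N l : ℝ) / totalSize N * Real.log (Real.cosh (y l)))
      = ∑ l, (N l : ℝ) * Real.log (2 * Real.cosh (y l)) := by
    have h3 : ∀ l, Real.log (2 * Real.cosh (y l)) = Real.log 2 + Real.log (Real.cosh (y l)) :=
      fun l => Real.log_mul two_ne_zero (Real.cosh_pos _).ne'
    simp only [h3, mul_add, Finset.sum_add_distrib, Finset.mul_sum, ← Finset.sum_mul]
    congr 1
    · simp [totalSize]
    · refine Finset.sum_congr rfl fun l _ => ?_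
      field_simp
  simp only [h1]
  rw [h2, sum_exp_magnetisation, Real.exp_sum]
  refine Finset.prod_congr rfl fun l _ => ?_
  rw [Real.exp_nat_mul, Real.exp_log (mul_pos two_pos (Real.cosh_pos _))]

/-! ### Exponential bounds and expectations -/

theorem le_partitionFunction {J : Matrix (Fin M) (Fin M) ℝ} (hJ : J.IsSymm)
    (hJ0 : ∀ u, 0 ≤ energyDensity J u) (N : Fin M → ℕ) (hN : 0 < totalSize N) (u : Fin M → ℝ) :
    Real.exp (totalSize N * (Real.log 2 - freeEnergy J (fun l => (N l : ℝ) / totalSize N) u))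
      ≤ partitionFunction J N := by
  calc _ = Real.exp (-(totalSize N * energyDensity J u)) *
        ∑ x : Config N, Real.exp (totalSize N *
          ((fun l => magnetisation N x l / totalSize N) ⬝ᵥ J.mulVec u)) := by
        rw [sum_exp_dotProduct N hN, ← Real.exp_add, freeEnergy]
        congr 1
        ring
    _ ≤ _ := by
        rw [Finset.mul_sum]
        refine Finset.sum_le_sum fun x _ => ?_
        rw [← Real.exp_add, neg_hamiltonian_eq J N hN, Real.exp_le_exp,
          energyDensity_tangent hJ (fun l => magnetisation N x l / totalSize N) u]
        have := mul_nonneg (Nat.cast_nonneg (α := ℝ) (totalSize N))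
          (hJ0 ((fun l => magnetisation N x l / totalSize N) - u))
        linarith

theorem sum_exp_neg_hamiltonian_le {J : Matrix (Fin M) (Fin M) ℝ} (hJ : J.IsSymm)
    (N : Fin M → ℕ) (hN : 0 < totalSize N) (u : Fin M → ℝ) (ε : ℝ) (A : Finset (Config N))
    (hA : ∀ x ∈ A, energyDensity J ((fun l => magnetisation N x l / totalSize N) - u) ≤ ε) :
    ∑ x ∈ A, Real.exp (-hamiltonian J N x) ≤ Real.exp (totalSize N *
      (ε + Real.log 2 - freeEnergy J (fun l => (N l : ℝ) / totalSize N) u)) := by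
  calc _ ≤ ∑ x ∈ A, Real.exp (totalSize N * (ε - energyDensity J u)) *
        Real.exp (totalSize N *
          ((fun l => magnetisation N x l / totalSize N) ⬝ᵥ J.mulVec u)) := by
        refine Finset.sum_le_sum fun x hx => ?_
        rw [← Real.exp_add, neg_hamiltonian_eq J N hN, Real.exp_le_exp,
          energyDensity_tangent hJ (fun l => magnetisation N x l / totalSize N) u]
        have := mul_le_mul_of_nonneg_left (hA x hx) (Nat.cast_nonneg (α := ℝ) (totalSize N))
        linarith
    _ ≤ ∑ x, Real.exp (totalSize N * (ε - energyDensity J u)) *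
        Real.exp (totalSize N *
          ((fun l => magnetisation N x l / totalSize N) ⬝ᵥ J.mulVec u)) :=
        Finset.sum_le_sum_of_subset_of_nonneg (Finset.subset_univ _)
          fun x _ _ => by positivity
    _ = _ := by
        rw [← Finset.mul_sum, sum_exp_dotProduct N hN, ← Real.exp_add, freeEnergy]
        congr 1
        ring

theorem expectation_mono (J : Matrix (Fin M) (Fin M) ℝ) (N : Fin M → ℕ)
    {f g : (Fin M → ℝ) → ℝ} (h : ∀ x, f (groupMean N x) ≤ g (groupMean N x)) :
    expectation J N f ≤ expectation J N g := by
  refine Finset.sum_le_sum fun x _ => mul_le_mul_of_nonneg_left (h x) ?_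
  have := partitionFunction_pos J N
  positivity

theorem expectation_add (J : Matrix (Fin M) (Fin M) ℝ) (N : Fin M → ℕ)
    (f g : (Fin M → ℝ) → ℝ) :
    expectation J N (fun v => f v + g v) = expectation J N f + expectation J N g := by
  simp only [expectation, mul_add, Finset.sum_add_distrib]

theorem expectation_const_mul (J : Matrix (Fin M) (Fin M) ℝ) (N : Fin M → ℕ) (c : ℝ)
    (f : (Fin M → ℝ) → ℝ) :
    expectation J N (fun v => c * f v) = c * expectation J N f := by
  simp only [expectation, Finset.mul_sum]
  exact Finset.sum_congr rfl fun x _ => by ring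

theorem expectation_const (J : Matrix (Fin M) (Fin M) ℝ) (N : Fin M → ℕ) (c : ℝ) :
    expectation J N (fun _ => c) = c := by
  simp only [expectation, ← Finset.sum_mul, ← Finset.mul_sum]
  have h : (partitionFunction J N)⁻¹ * ∑ x : Config N, Real.exp (-hamiltonian J N x) = 1 :=
    inv_mul_cancel₀ (partitionFunction_pos J N).ne'
  rw [h, one_mul]

theorem magnetisation_neg (N : Fin M → ℕ) (x : Config N) :
    magnetisation N (-x) = -magnetisation N x := by
  ext l
  simp [magnetisation, spin]

theorem expectation_neg (J : Matrix (Fin M) (Fin M) ℝ) (N : Fin M → ℕ)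
    (f : (Fin M → ℝ) → ℝ) :
    expectation J N (fun v => f (-v)) = expectation J N f := by
  refine Fintype.sum_equiv (Equiv.neg (Config N)) _ _ fun x => ?_
  have h1 : hamiltonian J N (-x) = hamiltonian J N x := by
    simp [hamiltonian, spin]
  have h2 : groupMean N (-x) = -groupMean N x := by
    ext l
    simp [groupMean, magnetisation_neg, neg_div]
  rw [Equiv.neg_apply, h1, h2]

/-! ### Concentration at the minimisers -/

theorem tendsto_expectation_indicator {J : Matrix (Fin M) (Fin M) ℝ} (hJ : J.IsSymm)
    (hJ0 : ∀ u, 0 ≤ energyDensity J u) {N : ℕ → Fin M → ℕ} {α : Fin M → ℝ}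
    (hN : Tendsto (fun n => totalSize (N n)) atTop atTop)
    (hα : ∀ l, Tendsto (fun n => (N n l : ℝ) / (totalSize (N n) : ℝ)) atTop (𝓝 (α l)))
    {m v : Fin M → ℝ} (hv : freeEnergy J α (α * m) < freeEnergy J α (α * v)) :
    ∃ U ∈ 𝓝 v, Tendsto (fun n => expectation J (N n) (U.indicator 1)) atTop (𝓝 0) := by
  set β : ℕ → Fin M → ℝ := fun n l => (N n l : ℝ) / totalSize (N n) with hβ
  have hβα : Tendsto β atTop (𝓝 α) := tendsto_pi_nhds.mpr hα
  set δ := freeEnergy J α (α * v) - freeEnergy J α (α * m) with hδ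
  have hδ0 : 0 < δ := sub_pos.mpr hv
  have hfree : ∀ u, Tendsto (fun n => freeEnergy J (β n) u) atTop (𝓝 (freeEnergy J α u)) :=
    fun u => tendsto_const_nhds.sub
      (tendsto_finsetSum _ fun l _ => (hα l).mul tendsto_const_nhds)
  -- Half of the gap δ survives replacing α by the actual group proportions; another δ/4 goes into
  -- the size of the neighbourhood, leaving the rate δ/4.
  have hev : ∀ᶠ n in atTop,
      δ / 2 < freeEnergy J (β n) (α * v) - freeEnergy J (β n) (α * m) :=
    ((hfree _).sub (hfree _)).eventually (lt_mem_nhds (half_lt_self hδ0))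
  have hcont : Continuous fun p : (Fin M → ℝ) × (Fin M → ℝ) =>
      energyDensity J (p.1 * p.2 - α * v) :=
    (continuous_energyDensity J).comp (by fun_prop)
  -- The proportions and the means vary jointly here because S/T is the product of the two.
  have hnear : ∀ᶠ p in 𝓝 α ×ˢ 𝓝 v, energyDensity J (p.1 * p.2 - α * v) < δ / 4 := by
    rw [← nhds_prod_eq]
    refine hcont.continuousAt.eventually (gt_mem_nhds ?_)
    simp [energyDensity, hδ0]
  obtain ⟨A, hA, U, hU, hAU⟩ := eventually_prod_iff.mp hnear
  refine ⟨{w | U w}, hU, ?_⟩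
  have hlim : Tendsto (fun n => Real.exp (-(totalSize (N n) * (δ / 4)))) atTop (𝓝 0) :=
    Real.tendsto_exp_neg_atTop_nhds_zero.comp
      ((tendsto_natCast_atTop_atTop.comp hN).atTop_mul_const (by positivity))
  refine tendsto_of_tendsto_of_tendsto_of_le_of_le' tendsto_const_nhds hlim ?_ ?_
  · refine Eventually.of_forall fun n => ?_
    rw [← expectation_const J (N n) 0]
    exact expectation_mono _ _ fun x => Set.indicator_nonneg (fun _ _ => zero_le_one) _
  · filter_upwards [hev, hβα.eventually hA, hN.eventually_gt_atTop 0] with n h1 h2 h3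
    classical
    have hT : (0 : ℝ) < totalSize (N n) := by exact_mod_cast h3
    have hub := sum_exp_neg_hamiltonian_le hJ (N n) h3 (α * v) (δ / 4)
      (Finset.univ.filter fun x => U (groupMean (N n) x)) fun x hx => by
        refine le_trans (le_of_eq ?_) (hAU h2 (Finset.mem_filter.mp hx).2).le
        congr 2
        ext l
        simp only [hβ, Pi.mul_apply]
        rw [div_mul_eq_mul_div, mul_groupMean]
    have hlb := le_partitionFunction hJ hJ0 (N n) h3 (α * m)
    have heq : expectation J (N n) (Set.indicator {w | U w} 1)
        = (∑ x with U (groupMean (N n) x), Real.exp (-hamiltonian J (N n) x))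
          / partitionFunction J (N n) := by
      simp only [expectation, Set.indicator_apply, Set.mem_ofPred_eq, Pi.one_apply,
        mul_ite, mul_one, mul_zero, Finset.sum_ite, Finset.sum_const_zero, add_zero,
        ← Finset.mul_sum]
      rw [inv_mul_eq_div]
    rw [heq, div_le_iff₀ (partitionFunction_pos J (N n))]
    refine hub.trans (le_trans ?_ (mul_le_mul_of_nonneg_left hlb (Real.exp_pos _).le))
    rw [← Real.exp_add, Real.exp_le_exp, ← mul_neg, ← mul_add]
    refine mul_le_mul_of_nonneg_left ?_ hT.le
    simp only [hβ] at h1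
    linarith

theorem tendsto_expectation_indicator_of_isCompact {J : Matrix (Fin M) (Fin M) ℝ}
    (hJ : J.IsSymm) (hJ0 : ∀ u, 0 ≤ energyDensity J u) {N : ℕ → Fin M → ℕ} {α : Fin M → ℝ}
    (hN : Tendsto (fun n => totalSize (N n)) atTop atTop)
    (hα : ∀ l, Tendsto (fun n => (N n l : ℝ) / (totalSize (N n) : ℝ)) atTop (𝓝 (α l)))
    {m : Fin M → ℝ} {K : Set (Fin M → ℝ)} (hK : IsCompact K)
    (hm : ∀ v ∈ K, freeEnergy J α (α * m) < freeEnergy J α (α * v)) :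
    Tendsto (fun n => expectation J (N n) (K.indicator 1)) atTop (𝓝 0) := by
  have nonneg : ∀ n (s : Set (Fin M → ℝ)), 0 ≤ expectation J (N n) (s.indicator 1) := by
    intro n s
    rw [← expectation_const J (N n) 0]
    exact expectation_mono _ _ fun x => Set.indicator_nonneg (fun _ _ => zero_le_one) _
  refine hK.induction_on
    (p := fun s => Tendsto (fun n => expectation J (N n) (s.indicator 1)) atTop (𝓝 0)) ?_ ?_ ?_ ?_
  · simp [expectation]
  · intro s t hst ht
    refine squeeze_zero (fun n => nonneg n s) (fun n => expectation_mono _ _ fun x => ?_) ht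
    exact Set.indicator_le_indicator_of_subset hst (fun _ => zero_le_one) _
  · intro s t hs ht
    refine squeeze_zero (fun n => nonneg n _) (fun n => ?_) (by simpa using hs.add ht)
    rw [← expectation_add]
    refine expectation_mono _ _ fun x => ?_
    by_cases h1 : groupMean (N n) x ∈ s <;> by_cases h2 : groupMean (N n) x ∈ t <;>
      simp [h1, h2]
  · intro v hv
    obtain ⟨U, hU, h⟩ := tendsto_expectation_indicator hJ hJ0 hN hα (hm v hv)
    exact ⟨U, mem_nhdsWithin_of_mem_nhds hU, h⟩

theorem tendsto_expectation_of_vanishing {J : Matrix (Fin M) (Fin M) ℝ}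
    (hJ : J.IsSymm) (hJ0 : ∀ u, 0 ≤ energyDensity J u) {N : ℕ → Fin M → ℕ} {α : Fin M → ℝ}
    (hN : Tendsto (fun n => totalSize (N n)) atTop atTop)
    (hα : ∀ l, Tendsto (fun n => (N n l : ℝ) / (totalSize (N n) : ℝ)) atTop (𝓝 (α l)))
    {m : Fin M → ℝ}
    (hm : ∀ v, v ≠ m → v ≠ -m → freeEnergy J α (α * m) < freeEnergy J α (α * v))
    {g : (Fin M → ℝ) → ℝ} (hg : Continuous g) {C : ℝ} (hC : ∀ v, |g v| ≤ C)
    (hgm : g m = 0) (hgm' : g (-m) = 0) :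
    Tendsto (fun n => expectation J (N n) g) atTop (𝓝 0) := by
  rw [Metric.tendsto_atTop']
  intro ε hε
  -- The closed sup-norm unit ball contains all group means, so off K only |g| < ε/2 occurs; K
  -- avoids ±m since g vanishes there.
  set K : Set (Fin M → ℝ) := Metric.closedBall 0 1 ∩ {v | ε / 2 ≤ |g v|} with hKdef
  have hK : IsCompact K :=
    (isCompact_closedBall 0 1).inter_right (isClosed_le continuous_const hg.abs)
  have hlim := tendsto_expectation_indicator_of_isCompact hJ hJ0 hN hα (m := m) hK fun v hv => by
    refine hm v ?_ ?_ <;> rintro rfl <;> have := hv.2 <;>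
      simp only [Set.mem_ofPred_eq, hgm, hgm', abs_zero] at this <;> linarith
  have hC0 : 0 ≤ C := (abs_nonneg _).trans (hC 0)
  have hbound : ∀ n x, |g (groupMean (N n) x)|
      ≤ ε / 2 + C * K.indicator 1 (groupMean (N n) x) := by
    intro n x
    by_cases h : groupMean (N n) x ∈ K
    · simp only [h, Set.indicator_of_mem, Pi.one_apply, mul_one]
      linarith [hC (groupMean (N n) x)]
    · simp only [h, not_false_eq_true, Set.indicator_of_notMem, mul_zero, add_zero]
      by_contra! h2
      refine h ⟨?_, h2.le⟩
      rw [mem_closedBall_zero_iff, pi_norm_le_iff_of_nonneg zero_le_one]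
      exact fun l => abs_groupMean_le_one _ _ _
  have hlim2 : Tendsto (fun n => C * expectation J (N n) (K.indicator 1)) atTop (𝓝 0) := by
    simpa using hlim.const_mul C
  obtain ⟨n₀, hn₀⟩ := eventually_atTop.mp (hlim2.eventually (gt_mem_nhds (half_pos hε)))
  refine ⟨n₀, fun n hn => ?_⟩
  have h1 : expectation J (N n) (fun v => ε / 2 + C * K.indicator 1 v)
      = ε / 2 + C * expectation J (N n) (K.indicator 1) := by
    rw [expectation_add, expectation_const, expectation_const_mul]
  have h2 : expectation J (N n) g ≤ ε / 2 + C * expectation J (N n) (K.indicator 1) :=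
    h1 ▸ expectation_mono _ _ fun x => (le_abs_self _).trans (hbound n x)
  have h3 : (-1) * expectation J (N n) g ≤ ε / 2 + C * expectation J (N n) (K.indicator 1) := by
    rw [← h1, ← expectation_const_mul]
    exact expectation_mono _ _ fun x => by
      rw [neg_one_mul]; exact (neg_le_abs _).trans (hbound n x)
  rw [Real.dist_eq, sub_zero, abs_lt]
  constructor <;> linarith [hn₀ n hn.le]

theorem tendsto_expectation {J : Matrix (Fin M) (Fin M) ℝ}
    (hJ : J.IsSymm) (hJ0 : ∀ u, 0 ≤ energyDensity J u) {N : ℕ → Fin M → ℕ} {α : Fin M → ℝ}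
    (hN : Tendsto (fun n => totalSize (N n)) atTop atTop)
    (hα : ∀ l, Tendsto (fun n => (N n l : ℝ) / (totalSize (N n) : ℝ)) atTop (𝓝 (α l)))
    {m : Fin M → ℝ}
    (hm : ∀ v, v ≠ m → v ≠ -m → freeEnergy J α (α * m) < freeEnergy J α (α * v))
    {f : (Fin M → ℝ) → ℝ} (hf : Continuous f) {C : ℝ} (hC : ∀ v, |f v| ≤ C) :
    Tendsto (fun n => expectation J (N n) f) atTop (𝓝 ((f (-m) + f m) / 2)) := by
  set c := f (-m) + f m with hc
  -- The symmetrised, centred function vanishes at both ±m, and by spin flip its expectation is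
  -- twice that of f, minus c.
  have h := tendsto_expectation_of_vanishing hJ hJ0 hN hα hm
    (g := fun v => f v + f (-v) + -c) (by fun_prop) (C := 4 * C) (fun v => ?_)
    (by simp only [hc]; ring) (by simp only [hc, neg_neg]; ring)
  · have h2 : ∀ n, expectation J (N n) (fun v => f v + f (-v) + -c)
        = 2 * expectation J (N n) f + -c := fun n => by
      rw [expectation_add, expectation_add, expectation_neg, expectation_const]
      ring
    simp only [h2] at h
    have h3 := (h.add_const c).div_const 2
    simpa using h3
  · have e1 := abs_le.mp (hC v)
    have e2 := abs_le.mp (hC (-v))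
    have e3 := abs_le.mp (hC m)
    have e4 := abs_le.mp (hC (-m))
    rw [abs_le]
    constructor <;> linarith

/-! ### Weak convergence of the laws -/

open MeasureTheory in
theorem integral_meanLaw (J : Matrix (Fin M) (Fin M) ℝ) (N : Fin M → ℕ)
    {f : (Fin M → ℝ) → ℝ} (hf : Continuous f) :
    ∫ v, f v ∂(meanLaw J N : Measure (Fin M → ℝ)) = expectation J N f := by
  let _ : MeasurableSpace (Config N) := ⊤
  have hmeas : Measurable fun (x : Config N) l => magnetisation N x l / (N l : ℝ) :=
    measurable_from_top
  change ∫ v, f v ∂((gibbs J N).map _).toMeasure = _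
  rw [← PMF.toMeasure_map _ _ hmeas, integral_map hmeas.aemeasurable hf.aestronglyMeasurable,
    PMF.integral_eq_sum]
  refine Finset.sum_congr rfl fun x _ => ?_
  have hZ := partitionFunction_pos J N
  rw [gibbs, PMF.ofFintype_apply, ENNReal.toReal_ofReal (by positivity), smul_eq_mul]
  rfl

open MeasureTheory in
theorem integral_twoPoint (m : Fin M → ℝ) {f : (Fin M → ℝ) → ℝ} (hf : Continuous f) :
    ∫ v, f v ∂(twoPoint m : Measure (Fin M → ℝ)) = (f (-m) + f m) / 2 := by
  change ∫ v, f v ∂((2⁻¹ : ℝ≥0∞) • (Measure.dirac (-m) + Measure.dirac m)) = _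
  have h : ∀ a, Integrable f (Measure.dirac a) := fun a =>
    integrable_dirac' hf.stronglyMeasurable (by simp)
  rw [integral_smul_measure, integral_add_measure (h _) (h _),
    integral_dirac' _ _ hf.stronglyMeasurable, integral_dirac' _ _ hf.stronglyMeasurable]
  simp
  ring

/-- If the free energy is minimal exactly at `±m`, the law of the group means converges weakly
to the symmetric two-point law at `±m`. -/
theorem tendsto_meanLaw {J : Matrix (Fin M) (Fin M) ℝ}
    (hJ : J.IsSymm) (hJ0 : ∀ u, 0 ≤ energyDensity J u) {N : ℕ → Fin M → ℕ} {α : Fin M → ℝ}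
    (hN : Tendsto (fun n => totalSize (N n)) atTop atTop)
    (hα : ∀ l, Tendsto (fun n => (N n l : ℝ) / (totalSize (N n) : ℝ)) atTop (𝓝 (α l)))
    {m : Fin M → ℝ}
    (hm : ∀ v, v ≠ m → v ≠ -m → freeEnergy J α (α * m) < freeEnergy J α (α * v)) :
    Tendsto (fun n => meanLaw J (N n)) atTop (𝓝 (twoPoint m)) := by
  rw [MeasureTheory.ProbabilityMeasure.tendsto_iff_forall_integral_tendsto]
  intro f
  simp only [integral_meanLaw _ _ f.continuous, integral_twoPoint _ f.continuous]
  exact tendsto_expectation hJ hJ0 hN hα hm f.continuous fun v => f.norm_coe_le_norm v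

/-! ### Two groups: dual variables and conclusion -/

theorem inv_fin_two_apply (J : Matrix (Fin 2) (Fin 2) ℝ) :
    J⁻¹ 0 0 = J 1 1 / J.det ∧ J⁻¹ 0 1 = -J 0 1 / J.det ∧ J⁻¹ 1 0 = -J 1 0 / J.det ∧
      J⁻¹ 1 1 = J 0 0 / J.det := by
  refine ⟨?_, ?_, ?_, ?_⟩ <;>
    simp [Matrix.inv_def, Matrix.adjugate_fin_two, Ring.inverse_eq_inv', div_eq_inv_mul]

/-- With p = Ju the energy (u, Ju) becomes (p, J⁻¹p). -/
theorem freeEnergy_eq_dualEnergy {J : Matrix (Fin 2) (Fin 2) ℝ} (hJ : J.PosDef)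
    (α u : Fin 2 → ℝ) :
    freeEnergy J α u = dualEnergy (L11 J) (L22 J) (L12 J) (α 0) (α 1)
      (J.mulVec u 0, J.mulVec u 1) := by
  have hdet := hJ.det_pos.ne'
  have hs : J 1 0 = J 0 1 := by simpa using hJ.isHermitian.apply 0 1
  obtain ⟨h00, h01, -, h11⟩ := inv_fin_two_apply J
  have hd : J.det = J 0 0 * J 1 1 - J 0 1 * J 0 1 := by rw [Matrix.det_fin_two, hs]
  have key : energyDensity J u = (L11 J * J.mulVec u 0 ^ 2
      - 2 * L12 J * J.mulVec u 0 * J.mulVec u 1 + L22 J * J.mulVec u 1 ^ 2) / 2 := by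
    rw [L11, L12, L22, h00, h01, h11]
    simp only [energyDensity, Matrix.mulVec, dotProduct, Fin.sum_univ_two, hs]
    field_simp
    rw [hd]
    ring
  rw [freeEnergy, key, dualEnergy, Fin.sum_univ_two]
  ring

theorem exists_neg_of_lowTemperature {J : Matrix (Fin 2) (Fin 2) ℝ} {α : Fin 2 → ℝ}
    (h : (α, J) ∈ lowTemperature 2) :
    ∃ x y : ℝ, (L11 J - α 0) * x ^ 2 - 2 * L12 J * x * y + (L22 J - α 1) * y ^ 2 < 0 := by
  obtain ⟨hp, hnot⟩ := h
  have hJ : J.PosDef := hp.2.2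
  by_contra! hpos
  have hs : J 1 0 = J 0 1 := by simpa using hJ.isHermitian.apply 0 1
  obtain ⟨-, h01, h10, -⟩ := inv_fin_two_apply J
  have hsymm : J⁻¹ 1 0 = J⁻¹ 0 1 := by rw [h01, h10, hs]
  have hpsd : (hessian α J).PosSemidef := by
    refine Matrix.PosSemidef.of_dotProduct_mulVec_nonneg ?_ fun v => ?_
    · exact hJ.isHermitian.inv.sub (Matrix.isHermitian_diagonal α)
    · have h := hpos (v 0) (v 1)
      simp only [hessian, Matrix.mulVec, dotProduct, Fin.sum_univ_two, star_trivial,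
        Matrix.sub_apply, Matrix.diagonal_apply_eq, hsymm,
        Matrix.diagonal_apply_ne α zero_ne_one, Matrix.diagonal_apply_ne α one_ne_zero]
      simp only [L11, L12, L22] at h
      linarith
  by_cases hpd : (hessian α J).PosDef
  · exact hnot (Or.inl ⟨hp, hpd⟩)
  · exact hnot (Or.inr ⟨hp, hpsd, hpd⟩)

end CurieWeiss

open CurieWeiss in
theorem mainTheorem6 (J : Matrix (Fin 2) (Fin 2) ℝ) (α : Fin 2 → ℝ) (N : ℕ → Fin 2 → ℕ)
    (hJ_pos : ∀ l m, 0 < J l m)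
    (hα_pos : ∀ l, 0 < α l)
    (hN : ∀ l, Filter.Tendsto (fun n => N n l) Filter.atTop Filter.atTop)
    (hα : ∀ l, Filter.Tendsto
      (fun n => (N n l : ℝ) / (CurieWeiss.totalSize (N n) : ℝ)) Filter.atTop (𝓝 (α l)))
    (h_low : (α, J) ∈ CurieWeiss.lowTemperature 2) :
    (∃! p : ℝ × ℝ, CurieWeiss.IsFirstQuadrantSolution J α p) ∧
      ∀ p : ℝ × ℝ, CurieWeiss.IsFirstQuadrantSolution J α p →
        Real.tanh p.1 ∈ Set.Ioo (0 : ℝ) 1 ∧ Real.tanh p.2 ∈ Set.Ioo (0 : ℝ) 1 ∧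
          Filter.Tendsto (fun n => CurieWeiss.meanLaw J (N n)) Filter.atTop
            (𝓝 (CurieWeiss.twoPoint ![Real.tanh p.1, Real.tanh p.2])) := by
  have hJ : J.PosDef := h_low.1.2.2
  have hdet := hJ.det_pos
  have hs : J 1 0 = J 0 1 := by simpa using hJ.isHermitian.apply 0 1
  have hd : J.det = J 0 0 * J 1 1 - J 0 1 * J 0 1 := by rw [Matrix.det_fin_two, hs]
  obtain ⟨h00, h01, -, h11⟩ := inv_fin_two_apply J
  have e11 : L11 J = J 1 1 / J.det := h00
  have e12 : L12 J = J 0 1 / J.det := by rw [L12, h01, neg_div, neg_neg]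
  have e22 : L22 J = J 0 0 / J.det := h11
  have ha : 0 < L11 J := e11 ▸ div_pos (hJ_pos 1 1) hdet
  have hb : 0 < L22 J := e22 ▸ div_pos (hJ_pos 0 0) hdet
  have hc : 0 < L12 J := e12 ▸ div_pos (hJ_pos 0 1) hdet
  have hLdet : L12 J ^ 2 < L11 J * L22 J := by
    rw [e11, e12, e22, div_pow, div_mul_div_comm, ← sq, div_lt_div_iff_of_pos_right (by positivity)]
    linarith
  obtain ⟨x, y, hxy⟩ := exists_neg_of_lowTemperature h_low
  obtain ⟨p, hp1, hp2, hc1, hc2, hmin⟩ :=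
    exists_positive_critical_point ha hb hc hLdet (hα_pos 0) (hα_pos 1) hxy
  have huniq : ∀ q, IsFirstQuadrantSolution J α q → q = p := fun q hq => by
    obtain ⟨h1, h2⟩ := positive_critical_unique hc (hα_pos 0) (hα_pos 1) hp1 hp2 hq.1 hq.2.1
      hc1 hc2 hq.2.2.1 hq.2.2.2
    exact Prod.ext h1 h2
  refine ⟨⟨p, ⟨hp1, hp2, hc1, hc2⟩, huniq⟩, fun q hq => ?_⟩
  rw [huniq q hq]
  refine ⟨⟨tanh_pos hp1, Real.tanh_lt_one _⟩, ⟨tanh_pos hp2, Real.tanh_lt_one _⟩, ?_⟩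
  have hsymm : J.IsSymm := by simpa [Matrix.IsHermitian, Matrix.IsSymm] using hJ.isHermitian
  have hJ0 : ∀ u, 0 ≤ energyDensity J u := fun u => by
    have := hJ.posSemidef.dotProduct_mulVec_nonneg u
    rw [star_trivial] at this
    exact div_nonneg this zero_le_two
  have hT : Filter.Tendsto (fun n => totalSize (N n)) Filter.atTop Filter.atTop :=
    Filter.tendsto_atTop_mono (fun n => Finset.single_le_sum (f := N n)
      (fun _ _ => Nat.zero_le _) (Finset.mem_univ 0)) (hN 0)
  set m : Fin 2 → ℝ := ![Real.tanh p.1, Real.tanh p.2] with hm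
  have hinj : Function.Injective J.mulVec :=
    Matrix.mulVec_injective_of_isUnit ((Matrix.isUnit_iff_isUnit_det J).mpr hdet.ne'.isUnit)
  have hαinj : ∀ v w : Fin 2 → ℝ, α * v = α * w → v = w := fun v w h => by
    ext l
    exact mul_left_cancel₀ (hα_pos l).ne' (congrFun h l)
  -- The system says J⁻¹p = α * tanh p = α * m.
  have hJm : J.mulVec (α * m) = ![p.1, p.2] := by
    rw [e11, e12] at hc1
    rw [e22, e12] at hc2
    have t1 : α 0 * Real.tanh p.1 = (J 1 1 * p.1 - J 0 1 * p.2) / J.det := by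
      rw [sub_div, ← div_mul_eq_mul_div, ← div_mul_eq_mul_div]; linarith
    have t2 : α 1 * Real.tanh p.2 = (J 0 0 * p.2 - J 0 1 * p.1) / J.det := by
      rw [sub_div, ← div_mul_eq_mul_div, ← div_mul_eq_mul_div]; linarith
    ext l
    fin_cases l <;> simp [Matrix.mulVec, dotProduct, Fin.sum_univ_two, hm, t1, t2, hs] <;>
      field_simp <;> rw [hd] <;> ring
  refine tendsto_meanLaw hsymm hJ0 hT hα fun v hv hv' => ?_
  rw [freeEnergy_eq_dualEnergy hJ, freeEnergy_eq_dualEnergy hJ, hJm]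
  -- The map v ↦ J(α * v) is injective, so only ±m are sent to the minimisers ±p.
  have hJext : ∀ w : Fin 2 → ℝ, J.mulVec (α * v) 0 = J.mulVec (α * w) 0 →
      J.mulVec (α * v) 1 = J.mulVec (α * w) 1 → v = w := fun w h0 h1 =>
    hαinj _ _ (hinj (funext fun l => by fin_cases l <;> assumption))
  refine hmin _ (fun h => hv (hJext m ?_ ?_)) fun h => hv' (hJext (-m) ?_ ?_)
  · simpa [hJm] using congrArg Prod.fst h
  · simpa [hJm] using congrArg Prod.snd h
  · rw [mul_neg, Matrix.mulVec_neg, hJm]; simpa using congrArg Prod.fst h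
  · rw [mul_neg, Matrix.mulVec_neg, hJm]; simpa using congrArg Prod.snd h
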